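/- Let $d\ge 1$, and let $\mathcal N(m,\Sigma)$ denote the Gaussian distribution on a Euclidean space with mean $m$ and positive semidefinite covariance $\Sigma$ (possibly singular). A finite Gaussian mixture is a finite convex combination of Gaussian distributions. For probability measures $\mu,\nu$ on $\mathbb R^d$ let $\Pi(\mu,\nu)$ be the set of probability measures on $\mathbb R^d\times\mathbb R^d$ with marginals $\mu$ and $\nu$, and put $$W_2^2(\mu,\nu)=\inf_{\gamma\in\Pi(\mu,\nu)}\int\|x-y\|^2\,d\gamma(x,y),\qquad MW_2^2(\mu,\nu)=\inf_{\gamma}\int\|x-y\|^2\,d\gamma(x,y),$$ where the second infimum is over those $\gamma\in\Pi(\mu,\nu)$ that are finite Gaussian mixtures on $\mathbb R^d\times\mathbb R^d=\mathbb R^{2d}$. A minimizer of the first (second) problem is called an optimal plan for $W_2$ (for $MW_2$). A $W_2$-optimal map from $\mu$ to $\nu$ is a measurable $T:\mathbb R^d\to\mathbb R^d$ such that $(\mathrm{Id},T)\#\mu$ is an optimal plan for $W_2$ between $\mu$ and $\nu$. Let $\mu_0=\sum_{k=1}^{K_0}\pi_0^k\mu_0^k$ and $\mu_1=\sum_{l=1}^{K_1}\pi_1^l\mu_1^l$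 with $\mu_i^k=\mathcal N(m_i^k,\Sigma_i^k)$, $\pi_i^k\ge 0$ and $\sum_k\pi_i^k=1$ for $i=0,1$. Let $\Pi(\pi_0,\pi_1)$ be the set of $K_0\times K_1$ matrices $w$ with nonnegative entries such that $\sum_l w_{kl}=\pi_0^k$ for all $k$ and $\sum_k w_{kl}=\pi_1^l$ for all $l$. Then $MW_2^2(\mu_0,\mu_1)$ is finite and $$MW_2^2(\mu_0,\mu_1)=\min_{w\in\Pi(\pi_0,\pi_1)}\sum_{k,l}w_{kl}\,W_2^2(\mu_0^k,\mu_1^l),$$ the minimum being attained. For all $k,l$ there is an optimal plan for $W_2$ between $\mu_0^k$ and $\mu_1^l$ that is a Gaussian distribution on $\mathbb R^{2d}$; and if $\Sigma_0^k$ is nonsingular, there is a $W_2$-optimal map from $\mu_0^k$ to $\mu_1^l$, unique up to $\mu_0^k$-null sets. Moreover, let $w^*$ be any minimizer of the discrete problem. (i) If, for all $k,l$, $\gamma_{kl}$ is a Gaussian optimal plan for $W_2$ between $\mu_0^k$ and $\mu_1^l$, then $\gamma^*=\sum_{k,l}w^*_{kl}\gamma_{kl}$ is an optimal plan for $MW_2$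 between $\mu_0$ and $\mu_1$ (in particular it is a finite Gaussian mixture in $\Pi(\mu_0,\mu_1)$). (ii) If all $\Sigma_0^k$ are nonsingular and, for all $k,l$, $T_{kl}$ is a $W_2$-optimal map from $\mu_0^k$ to $\mu_1^l$, then $\gamma^*=\sum_{k,l}w^*_{kl}\,(\mathrm{Id},T_{kl})\#\mu_0^k$ is an optimal plan for $MW_2$ between $\mu_0$ and $\mu_1$. -/

import Mathlib

open MeasureTheory ProbabilityTheory
open scoped NNReal ENNReal

namespace GMMTransport

/-- Finite Gaussian mixtures on `E`: finite convex combinations of Gaussian measures, where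
degenerate (singular covariance) Gaussian measures are allowed. -/
def IsGaussianMixture {E : Type*} [TopologicalSpace E] [AddCommMonoid E] [Module ℝ E]
    [MeasurableSpace E] (μ : Measure E) : Prop :=
  ∃ (K : ℕ) (p : Fin K → ℝ≥0) (ν : Fin K → Measure E),
    ∑ k, p k = 1 ∧ (∀ k, IsGaussian (ν k)) ∧ μ = ∑ k, p k • ν k

/-- `ℝ^d` with the Euclidean norm. -/
abbrev Euc (d : ℕ) : Type := EuclideanSpace ℝ (Fin d)

/-- The set `Π(μ, ν)` of probability measures on `ℝ^d × ℝ^d` with marginals `μ` and `ν`. -/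
def couplings {d : ℕ} (μ ν : Measure (Euc d)) : Set (Measure (Euc d × Euc d)) :=
  {γ | IsProbabilityMeasure γ ∧ γ.map Prod.fst = μ ∧ γ.map Prod.snd = ν}

/-- The elements of `Π(μ, ν)` that are finite Gaussian mixtures on `ℝ^d × ℝ^d = ℝ^{2d}`. -/
def gmmCouplings {d : ℕ} (μ ν : Measure (Euc d)) : Set (Measure (Euc d × Euc d)) :=
  couplings μ ν ∩ {γ | IsGaussianMixture γ}

/-- The quadratic transport cost `∫ ‖x - y‖² dγ(x, y)`, with values in `[0, ∞]`. -/
noncomputable def cost {d : ℕ} (γ : Measure (Euc d × Euc d)) : ℝ≥0∞ :=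
  ∫⁻ z, ‖z.1 - z.2‖ₑ ^ 2 ∂γ

/-- The squared Wasserstein distance `W₂²`. -/
noncomputable def W2sq {d : ℕ} (μ ν : Measure (Euc d)) : ℝ≥0∞ :=
  ⨅ γ ∈ couplings μ ν, cost γ

/-- `MW₂²`: the optimal transport cost restricted to Gaussian mixture couplings. -/
noncomputable def MW2sq {d : ℕ} (μ ν : Measure (Euc d)) : ℝ≥0∞ :=
  ⨅ γ ∈ gmmCouplings μ ν, cost γ

/-- `γ` is an optimal transport plan for `W₂` between `μ` and `ν`. -/
def IsW2OptimalPlan {d : ℕ} (μ ν : Measure (Euc d)) (γ : Measure (Euc d × Euc d)) : Prop :=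
  γ ∈ couplings μ ν ∧ IsMinOn cost (couplings μ ν) γ

/-- `γ` is an optimal transport plan for `MW₂` between `μ` and `ν`. -/
def IsMW2OptimalPlan {d : ℕ} (μ ν : Measure (Euc d)) (γ : Measure (Euc d × Euc d)) : Prop :=
  γ ∈ gmmCouplings μ ν ∧ IsMinOn cost (gmmCouplings μ ν) γ

/-- The plan `(Id, T)#μ`, also written `μ(x) δ_{y = T(x)}`. -/
noncomputable def graphPlan {d : ℕ} (μ : Measure (Euc d)) (T : Euc d → Euc d) :
    Measure (Euc d × Euc d) :=
  μ.map fun x => (x, T x)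

/-- `T` is an optimal transport map for `W₂` from `μ` to `ν`. -/
def IsW2OptimalMap {d : ℕ} (μ ν : Measure (Euc d)) (T : Euc d → Euc d) : Prop :=
  Measurable T ∧ IsW2OptimalPlan μ ν (graphPlan μ T)

/-- The set `Π(p, q)` of nonnegative matrices with row sums `p` and column sums `q`. -/
def discreteCouplings {K L : ℕ} (p : Fin K → ℝ≥0) (q : Fin L → ℝ≥0) :
    Set (Matrix (Fin K) (Fin L) ℝ≥0) :=
  {w | (∀ k, ∑ l, w k l = p k) ∧ ∀ l, ∑ k, w k l = q l}

/-- The discrete objective `∑_{k,l} w_{kl} W₂²(μ_k, ν_l)`. -/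
noncomputable def discreteCost {d K L : ℕ} (μ : Fin K → Measure (Euc d))
    (ν : Fin L → Measure (Euc d)) (w : Matrix (Fin K) (Fin L) ℝ≥0) : ℝ≥0∞ :=
  ∑ k, ∑ l, (w k l : ℝ≥0∞) * W2sq (μ k) (ν l)

end GMMTransport

/-! The upper bound is gluing: mixing Gaussian optimal plans with weights from a discrete coupling
gives a Gaussian mixture coupling with exactly the discrete cost (`sum_smul_mem_gmmCouplings`).

The lower bound rests on identifiability of Gaussian mixtures. If a coupling is a mixture of
Gaussians `ν j`, its marginals are mixtures of the marginals of the `ν j`. Distinct Gaussians,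
singular ones included, are linearly independent, so each `ν j` of positive weight must be a
coupling of some component of the source with some component of the target, and costs at least their
`W2sq`. Collecting weights gives a discrete coupling that is no more expensive
(`gaussianMixture_identifiable`, `exists_discreteCost_le`). Components may repeat or have weight
zero, hence the redistribution in `exists_weight_splitting`.

For two Gaussians the cost of a coupling depends on its covariance matrix alone. The admissible
covariance matrices form a compact set and each is realised by a Gaussian coupling, so maximising a
linear functional gives a Gaussian optimal plan (`exists_gaussian_optimalPlan`). When the source
covariance is nonsingular, an affine map with positive semidefinite linear part carries source to
target; a quadratic duality identity shows that a coupling is optimal exactly when it lives on the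
graph of this map (`isW2OptimalPlan_iff_of_affine`). Every optimal map is therefore affine almost
everywhere and its graph plan is Gaussian, so (ii) reduces to (i). -/

namespace GMMTransport

/-! ### Identifiability of finite Gaussian mixtures -/

open Filter Topology in
/-- If `(b, a)` is lexicographically negative, then `exp (a s + b s² / 2)` tends to zero. -/
lemma tendsto_exp_quadratic_zero {a b : ℝ} (h : b < 0 ∨ b = 0 ∧ a < 0) :
    Tendsto (fun s : ℝ => Real.exp (a * s + b * s ^ 2 / 2)) atTop (𝓝 0) := by
  refine Real.tendsto_exp_atBot.comp ?_
  rcases h with hb | ⟨rfl, ha⟩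
  · have h1 : Tendsto (fun s : ℝ => a + b / 2 * s) atTop atBot :=
      tendsto_atBot_add_const_left _ _
        (tendsto_id.const_mul_atTop_of_neg (by linarith : b / 2 < 0))
    have h2 := tendsto_id.atTop_mul_atBot₀ h1
    refine h2.congr fun s => ?_
    simp only [id]
    ring
  · refine (tendsto_id.const_mul_atTop_of_neg ha).congr fun s => ?_
    simp

open Filter Topology in
/-- Distinct functions `exp (a s + b s² / 2)` are linearly independent. -/
lemma eq_zero_of_sum_exp_quadratic {ι : Type*} [Fintype ι] {a b c : ι → ℝ}
    (hab : ∀ i j, a i = a j → b i = b j → i = j)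
    (h : ∀ s : ℝ, ∑ i, c i * Real.exp (a i * s + b i * s ^ 2 / 2) = 0) : c = 0 := by
  classical
  by_contra hc
  obtain ⟨i₀, hi₀⟩ : ∃ i, c i ≠ 0 := by
    by_contra! h'
    exact hc (funext h')
  -- The fastest growing term as `s → ∞` is the lexicographically largest `(b, a)` among nonzero
  -- coefficients. Dividing by its exponential makes the sum tend to `c i`, while the sum is
  -- identically zero.
  obtain ⟨i, hi, hmax⟩ := Finset.exists_max_image (Finset.univ.filter fun i => c i ≠ 0)
    (fun i => toLex (b i, a i)) ⟨i₀, by simpa using hi₀⟩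
  simp only [Finset.mem_filter, Finset.mem_univ, true_and] at hi hmax
  have hterm : ∀ j, Tendsto
      (fun s : ℝ => c j * Real.exp ((a j - a i) * s + (b j - b i) * s ^ 2 / 2)) atTop
      (𝓝 (if j = i then c i else 0)) := by
    intro j
    split_ifs with hji
    · subst hji
      simp
    · by_cases hj : c j = 0
      · simp [hj]
      · have hle := hmax j hj
        rw [Prod.Lex.toLex_le_toLex] at hle
        have : b j - b i < 0 ∨ b j - b i = 0 ∧ a j - a i < 0 := by
          rcases hle with hlt | ⟨heq, hle⟩
          · exact Or.inl (by simpa using hlt)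
          · refine Or.inr ⟨by simpa [sub_eq_zero] using heq, ?_⟩
            have : a j ≠ a i := fun h' => hji (hab _ _ h' heq)
            simpa using lt_of_le_of_ne hle this
        simpa using (tendsto_exp_quadratic_zero this).const_mul (c j)
  have hsum := tendsto_finsetSum Finset.univ fun j _ => hterm j
  simp only [Finset.sum_ite_eq', Finset.mem_univ, if_true] at hsum
  refine hi (tendsto_nhds_unique hsum (tendsto_const_nhds.congr fun s => ?_))
  have := congrArg (· * Real.exp (-(a i * s + b i * s ^ 2 / 2))) (h s)
  simp only [zero_mul, Finset.sum_mul, mul_assoc, ← Real.exp_add] at this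
  rw [← this]
  refine Finset.sum_congr rfl fun j _ => ?_
  congr 2
  ring

/-- The logarithm of the moment generating function of a Gaussian measure. -/
noncomputable def gaussianCgf {d : ℕ} (μ : Measure (Euc d)) (t : Euc d) : ℝ :=
  inner ℝ t (∫ x, x ∂μ) + covarianceBilin μ t t / 2

/-- Comparing the values at `t` and `-t` separates the odd part, which is the mean, from the even
part, which is the covariance; these determine the characteristic function. -/
lemma gaussianCgf_injective {d : ℕ} {μ ν : Measure (Euc d)} [IsGaussian μ] [IsGaussian ν]
    (h : gaussianCgf μ = gaussianCgf ν) : μ = ν := by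
  have h1 := fun t => congrFun h t
  simp only [gaussianCgf] at h1
  have h2 : ∀ t, inner ℝ t (∫ x, x ∂μ) = inner ℝ t (∫ x, x ∂ν) ∧
      covarianceBilin μ t t = covarianceBilin ν t t := by
    intro t
    have ht := h1 t
    have ht' := h1 (-t)
    simp only [inner_neg_left, map_neg, neg_apply, neg_neg] at ht'
    constructor <;> linarith
  refine Measure.ext_of_charFun (funext fun t => ?_)
  simp only [IsGaussian.charFun_eq', id]
  rw [(h2 t).1, (h2 t).2]

/-- `gaussianCgf μ` as a polynomial in the coordinates. -/
noncomputable def cgfPolynomial {d : ℕ} (μ : Measure (Euc d)) : MvPolynomial (Fin d) ℝ :=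
  ∑ i, MvPolynomial.C ((∫ x, x ∂μ) i) * MvPolynomial.X i +
    ∑ i, ∑ j, MvPolynomial.C (covarianceBilin μ (EuclideanSpace.basisFun _ ℝ i)
      (EuclideanSpace.basisFun _ ℝ j) / 2) * (MvPolynomial.X i * MvPolynomial.X j)

lemma eval_cgfPolynomial {d : ℕ} (μ : Measure (Euc d)) (t : Euc d) :
    MvPolynomial.eval (fun i => t i) (cgfPolynomial μ) = gaussianCgf μ t := by
  have ht : t = ∑ i, t i • EuclideanSpace.basisFun (Fin d) ℝ i := by
    ext i
    simp [Finset.sum_apply, Pi.single_apply]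
  have hcov : covarianceBilin μ t t = ∑ i, ∑ j, t i * t j *
      covarianceBilin μ (EuclideanSpace.basisFun _ ℝ i) (EuclideanSpace.basisFun _ ℝ j) := by
    conv_lhs => rw [ht]
    simp only [map_sum, map_smul, sum_apply, smul_apply,
      smul_eq_mul, Finset.mul_sum]
    exact Finset.sum_congr rfl fun i _ => Finset.sum_congr rfl fun j _ => by
      rw [covarianceBilin_comm]; ring
  rw [gaussianCgf, hcov, cgfPolynomial, PiLp.inner_apply]
  simp only [map_add, map_sum, map_mul, MvPolynomial.eval_C, MvPolynomial.eval_X]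
  rw [Finset.sum_div]
  congr 1
  refine Finset.sum_congr rfl fun i _ => ?_
  rw [Finset.sum_div]
  exact Finset.sum_congr rfl fun j _ => by ring

/-- Finitely many distinct Gaussian measures are separated by the value of their cumulant
generating functions at a single point. -/
lemma exists_gaussianCgf_ne {d : ℕ} {ι : Type*} [Fintype ι] (α : ι → Measure (Euc d))
    [∀ i, IsGaussian (α i)] (hα : Function.Injective α) :
    ∃ t : Euc d, ∀ i j, i ≠ j → gaussianCgf (α i) t ≠ gaussianCgf (α j) t := by
  classical
  -- Each factor is a nonzero polynomial, so the product is nonzero and has a nonzero value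
  -- somewhere; at such a point no two cumulant generating functions agree.
  set P : MvPolynomial (Fin d) ℝ := ∏ x ∈ Finset.univ.filter (fun x : ι × ι => x.1 ≠ x.2),
    (cgfPolynomial (α x.1) - cgfPolynomial (α x.2)) with hPdef
  have hP : P ≠ 0 := by
    refine Finset.prod_ne_zero_iff.2 fun x hx h0 => ?_
    refine (Finset.mem_filter.1 hx).2 (hα (gaussianCgf_injective (funext fun t => ?_)))
    rw [← eval_cgfPolynomial, ← eval_cgfPolynomial, sub_eq_zero.1 h0]
  obtain ⟨t, ht⟩ : ∃ t, MvPolynomial.eval t P ≠ 0 := by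
    by_contra! h
    exact hP (MvPolynomial.funext fun t => by simpa using h t)
  refine ⟨WithLp.toLp 2 t, fun i j hij h => ht ?_⟩
  rw [hPdef, map_prod]
  refine Finset.prod_eq_zero (i := (i, j)) (by simpa using hij) ?_
  rw [map_sub, sub_eq_zero]
  rwa [← eval_cgfPolynomial, ← eval_cgfPolynomial] at h

/-- Along the ray `s • t` a mixture becomes a sum of functions `exp (a s + b s² / 2)`, so linear
independence of measures reduces to that of such functions. With lower integrals, sums of measures
need no integrability conditions. -/
lemma lintegral_exp_inner_gaussian {d : ℕ} (μ : Measure (Euc d)) [IsGaussian μ] (t : Euc d)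
    (s : ℝ) : ∫⁻ x, ENNReal.ofReal (Real.exp (s * inner ℝ t x)) ∂μ =
      ENNReal.ofReal (Real.exp (inner ℝ t (∫ x, x ∂μ) * s + covarianceBilin μ t t * s ^ 2 / 2)) := by
  have hmap := IsGaussian.map_eq_gaussianReal (μ := μ) (innerSL ℝ t)
  have hmgf := mgf_gaussianReal hmap s
  have hint : Integrable (fun x => Real.exp (s * inner ℝ t x)) μ := by
    have := integrable_exp_mul_gaussianReal (μ := ∫ x, innerSL ℝ t x ∂μ)
      (v := Var[innerSL ℝ t; μ].toNNReal) s
    rw [← hmap, integrable_map_measure (by fun_prop) (by fun_prop)] at this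
    exact this
  rw [← ofReal_integral_eq_lintegral_ofReal hint (ae_of_all _ fun x => (Real.exp_pos _).le)]
  congr 1
  have hmean : ∫ x, innerSL ℝ t x ∂μ = inner ℝ t (∫ x, x ∂μ) :=
    integral_inner IsGaussian.integrable_id t
  have hvar : (Var[innerSL ℝ t; μ].toNNReal : ℝ) = covarianceBilin μ t t := by
    rw [Real.coe_toNNReal _ (variance_nonneg _ _), covarianceBilin_self IsGaussian.memLp_two_id]
    rfl
  rw [hmean, hvar] at hmgf
  exact hmgf

/-- Distinct Gaussian measures are linearly independent. -/
lemma gaussian_weights_unique {d : ℕ} {ι : Type*} [Fintype ι] (α : ι → Measure (Euc d))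
    [∀ i, IsGaussian (α i)] (hα : Function.Injective α) {p q : ι → ℝ≥0}
    (h : ∑ i, p i • α i = ∑ i, q i • α i) : p = q := by
  obtain ⟨t, ht⟩ := exists_gaussianCgf_ne α hα
  have key := eq_zero_of_sum_exp_quadratic (a := fun i => inner ℝ t (∫ x, x ∂α i))
    (b := fun i => covarianceBilin (α i) t t) (c := fun i => (p i : ℝ) - q i)
    (fun i j ha hb => by
      by_contra hij
      exact ht i j hij (by simp only [gaussianCgf]; rw [ha, hb]))
    (fun s => by
      have := congrArg (fun μ => ∫⁻ x, ENNReal.ofReal (Real.exp (s * inner ℝ t x)) ∂μ) h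
      simp only [lintegral_finsetSum_measure, lintegral_smul_measure,
        lintegral_exp_inner_gaussian] at this
      have h2 := congrArg ENNReal.toReal this
      rw [ENNReal.toReal_sum (by simp [ENNReal.smul_def, ENNReal.mul_eq_top]),
        ENNReal.toReal_sum (by simp [ENNReal.smul_def, ENNReal.mul_eq_top])] at h2
      simp only [ENNReal.smul_def, smul_eq_mul, ENNReal.toReal_mul, ENNReal.coe_toReal,
        ENNReal.toReal_ofReal (Real.exp_pos _).le] at h2
      simp only [sub_mul, Finset.sum_sub_distrib]
      exact sub_eq_zero.2 h2)
  funext i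
  exact NNReal.coe_injective (sub_eq_zero.1 (congrFun key i))

-- Merges equal components, so that linear independence, stated for injective families, applies to
-- families with repetitions.
open scoped Classical in
lemma sum_fiber_weights_smul {d : ℕ} {ι : Type*} [Fintype ι] {α : ι → Measure (Euc d)}
    {p : ι → ℝ≥0} {s : Finset (Measure (Euc d))} (hα : ∀ i, α i ∈ s) :
    ∑ x : s, (∑ i with α i = x, p i) • (x : Measure (Euc d)) = ∑ i, p i • α i := by
  rw [Finset.sum_coe_sort s fun x => (∑ i with α i = x, p i) • x,
    ← Finset.sum_fiberwise_of_maps_to (s := Finset.univ) (t := s) (fun i _ => hα i)]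
  refine Finset.sum_congr rfl fun x _ => ?_
  rw [Finset.sum_smul]
  refine Finset.sum_congr rfl fun i hi => ?_
  rw [(Finset.mem_filter.1 hi).2]

/-- Two representations of the same finite Gaussian mixture give the same total weight to each
Gaussian measure. -/
lemma gaussianMixture_identifiable {d : ℕ} {ι κ : Type*} [Fintype ι] [Fintype κ]
    (α : ι → Measure (Euc d)) (β : κ → Measure (Euc d)) [∀ i, IsGaussian (α i)]
    [∀ k, IsGaussian (β k)] {p : ι → ℝ≥0} {q : κ → ℝ≥0}
    (h : ∑ i, p i • α i = ∑ k, q k • β k) (g : Measure (Euc d)) :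
    open scoped Classical in
    ∑ i with α i = g, p i = ∑ k with β k = g, q k := by
  classical
  set s : Finset (Measure (Euc d)) := Finset.univ.image α ∪ Finset.univ.image β with hs
  have hαs : ∀ i, α i ∈ s := fun i => by simp [hs]
  have hβs : ∀ k, β k ∈ s := fun k => by simp [hs]
  by_cases hg : g ∈ s
  · have : ∀ x : s, IsGaussian (x : Measure (Euc d)) := by
      rintro ⟨x, hx⟩
      simp only [hs, Finset.mem_union, Finset.mem_image, Finset.mem_univ, true_and] at hx
      rcases hx with ⟨i, rfl⟩ | ⟨k, rfl⟩ <;> infer_instance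
    have := gaussian_weights_unique (fun x : s => (x : Measure (Euc d))) Subtype.val_injective
      (p := fun x => ∑ i with α i = x, p i) (q := fun x => ∑ k with β k = x, q k)
      (by rw [sum_fiber_weights_smul hαs, sum_fiber_weights_smul hβs, h])
    exact congrFun this ⟨g, hg⟩
  · rw [Finset.sum_eq_zero, Finset.sum_eq_zero]
    · rintro k hk
      exact absurd ((Finset.mem_filter.1 hk).2 ▸ hβs k) hg
    · rintro i hi
      exact absurd ((Finset.mem_filter.1 hi).2 ▸ hαs i) hg

/-! ### Couplings with finite second moments -/

section Couplings

variable {d : ℕ} {μ ν : Measure (Euc d)} {γ : Measure (Euc d × Euc d)}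

lemma memLp_fst_of_coupling (hμ : MemLp id 2 μ) (hγ : γ ∈ couplings μ ν) :
    MemLp (fun z : Euc d × Euc d => z.1) 2 γ := by
  rw [← hγ.2.1] at hμ
  exact hμ.comp_of_map measurable_fst.aemeasurable

lemma memLp_snd_of_coupling (hν : MemLp id 2 ν) (hγ : γ ∈ couplings μ ν) :
    MemLp (fun z : Euc d × Euc d => z.2) 2 γ := by
  rw [← hγ.2.2] at hν
  exact hν.comp_of_map measurable_snd.aemeasurable

lemma memLp_coord {Ω : Type*} {mΩ : MeasurableSpace Ω} {P : Measure Ω} {f : Ω → Euc d}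
    (hf : MemLp f 2 P) (i : Fin d) : MemLp (fun ω => f ω i) 2 P :=
  (EuclideanSpace.proj (𝕜 := ℝ) i : Euc d →L[ℝ] ℝ).comp_memLp' hf

lemma integrable_inner_of_memLp {Ω : Type*} {mΩ : MeasurableSpace Ω} {P : Measure Ω}
    {f g : Ω → Euc d} (hf : MemLp f 2 P) (hg : MemLp g 2 P) :
    Integrable (fun ω => inner ℝ (f ω) (g ω)) P := by
  refine (hf.norm.integrable_mul hg.norm).mono' (hf.1.inner hg.1) (ae_of_all _ fun ω => ?_)
  exact norm_inner_le_norm _ _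

lemma integral_fst_of_coupling (hγ : γ ∈ couplings μ ν) {f : Euc d → ℝ}
    (hf : Continuous f) : ∫ z, f z.1 ∂γ = ∫ x, f x ∂μ := by
  rw [← hγ.2.1, integral_map measurable_fst.aemeasurable hf.aestronglyMeasurable]

lemma integral_snd_of_coupling (hγ : γ ∈ couplings μ ν) {f : Euc d → ℝ}
    (hf : Continuous f) : ∫ z, f z.2 ∂γ = ∫ y, f y ∂ν := by
  rw [← hγ.2.2, integral_map measurable_snd.aemeasurable hf.aestronglyMeasurable]

lemma cost_eq_ofReal_integral (hμ : MemLp id 2 μ) (hν : MemLp id 2 ν) (hγ : γ ∈ couplings μ ν) :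
    cost γ = ENNReal.ofReal (∫ z, ‖z.1 - z.2‖ ^ 2 ∂γ) := by
  have hint : Integrable (fun z : Euc d × Euc d => ‖z.1 - z.2‖ ^ 2) γ :=
    ((memLp_fst_of_coupling hμ hγ).sub (memLp_snd_of_coupling hν hγ)).integrable_norm_pow (by simp)
  rw [ofReal_integral_eq_lintegral_ofReal hint (ae_of_all _ fun z => by positivity), cost]
  refine lintegral_congr fun z => ?_
  rw [ENNReal.ofReal_pow (norm_nonneg _), ofReal_norm]

lemma integral_norm_sub_sq_of_coupling (hμ : MemLp id 2 μ) (hν : MemLp id 2 ν)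
    (hγ : γ ∈ couplings μ ν) :
    ∫ z, ‖z.1 - z.2‖ ^ 2 ∂γ =
      ∫ x, ‖x‖ ^ 2 ∂μ + ∫ y, ‖y‖ ^ 2 ∂ν - 2 * ∫ z, inner ℝ z.1 z.2 ∂γ := by
  have h1 := memLp_fst_of_coupling hμ hγ
  have h2 := memLp_snd_of_coupling hν hγ
  rw [← integral_fst_of_coupling hγ (by fun_prop : Continuous fun x : Euc d => ‖x‖ ^ 2),
    ← integral_snd_of_coupling hγ (by fun_prop : Continuous fun x : Euc d => ‖x‖ ^ 2),
    ← integral_const_mul, ← integral_add, ← integral_sub]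
  · refine integral_congr_ae (ae_of_all _ fun z => ?_)
    simp only [norm_sub_sq_real]
    ring
  · exact (h1.integrable_norm_pow (by simp)).add (h2.integrable_norm_pow (by simp))
  · exact (integrable_inner_of_memLp h1 h2).const_mul 2
  · exact h1.integrable_norm_pow (by simp)
  · exact h2.integrable_norm_pow (by simp)

/-- The marginals fix both second moments, so minimising the cost is maximising the correlation `∫
⟨x, y⟩`. -/
lemma cost_le_cost_iff {γ' : Measure (Euc d × Euc d)} (hμ : MemLp id 2 μ)
    (hν : MemLp id 2 ν) (hγ : γ ∈ couplings μ ν) (hγ' : γ' ∈ couplings μ ν) :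
    cost γ ≤ cost γ' ↔ ∫ z, inner ℝ z.1 z.2 ∂γ' ≤ ∫ z, inner ℝ z.1 z.2 ∂γ := by
  rw [cost_eq_ofReal_integral hμ hν hγ, cost_eq_ofReal_integral hμ hν hγ',
    ENNReal.ofReal_le_ofReal_iff (integral_nonneg fun z => by positivity),
    integral_norm_sub_sq_of_coupling hμ hν hγ, integral_norm_sub_sq_of_coupling hμ hν hγ']
  constructor <;> intro h <;> linarith

lemma prod_mem_couplings [IsProbabilityMeasure μ] [IsProbabilityMeasure ν] :
    μ.prod ν ∈ couplings μ ν := by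
  refine ⟨inferInstance, ?_, ?_⟩ <;> simp

lemma W2sq_ne_top [IsProbabilityMeasure μ] [IsProbabilityMeasure ν] (hμ : MemLp id 2 μ)
    (hν : MemLp id 2 ν) : W2sq μ ν ≠ ∞ := by
  refine ne_top_of_le_ne_top ?_ (iInf₂_le (μ.prod ν) prod_mem_couplings)
  rw [cost_eq_ofReal_integral hμ hν prod_mem_couplings]
  exact ENNReal.ofReal_ne_top

lemma cost_eq_W2sq (h : IsW2OptimalPlan μ ν γ) : cost γ = W2sq μ ν :=
  le_antisymm (le_iInf₂ fun _ hγ' => h.2 hγ') (iInf₂_le γ h.1)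

end Couplings

/-! ### Gaussian optimal plans through covariance matrices -/

section BlockCovariance

variable {d : ℕ}

/-- The covariance matrices on `ℝ^d × ℝ^d` with prescribed diagonal blocks. -/
def blockCovariances (S₀ S₁ : Matrix (Fin d) (Fin d) ℝ) :
    Set (Matrix (Fin d ⊕ Fin d) (Fin d ⊕ Fin d) ℝ) :=
  {F | F.PosSemidef ∧ F.toBlocks₁₁ = S₀ ∧ F.toBlocks₂₂ = S₁}

lemma isClosed_posSemidef {ι : Type*} [Fintype ι] :
    IsClosed {F : Matrix ι ι ℝ | F.PosSemidef} := by
  simp only [Matrix.posSemidef_iff_dotProduct_mulVec, Set.ofPred_and, Set.ofPred_forall]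
  refine IsClosed.inter ?_ (isClosed_iInter fun x => ?_)
  · exact isClosed_eq (by fun_prop) (by fun_prop)
  · exact isClosed_le (by fun_prop) (by fun_prop)

/-- Test the quadratic form on `e_a + e_b` and `e_a - e_b`. The prescribed diagonal thus bounds
every entry, which gives compactness. -/
lemma abs_le_of_posSemidef {ι : Type*} [Fintype ι] [DecidableEq ι] {F : Matrix ι ι ℝ}
    (hF : F.PosSemidef) (a b : ι) : |F a b| ≤ (F a a + F b b) / 2 := by
  have hsymm : F b a = F a b := by simpa using hF.1.apply a b
  have h1 := hF.dotProduct_mulVec_nonneg (Pi.single a 1 + Pi.single b 1)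
  have h2 := hF.dotProduct_mulVec_nonneg (Pi.single a 1 - Pi.single b 1)
  simp [Matrix.mulVec_add, Matrix.mulVec_sub, add_dotProduct, sub_dotProduct, dotProduct_add,
    dotProduct_sub, hsymm] at h1 h2
  rw [abs_le]
  constructor <;> linarith

lemma isCompact_blockCovariances (S₀ S₁ : Matrix (Fin d) (Fin d) ℝ) :
    IsCompact (blockCovariances S₀ S₁) := by
  set D : Fin d ⊕ Fin d → ℝ := Sum.elim (fun i => S₀ i i) (fun i => S₁ i i)
  have hbox : IsCompact (Set.univ.pi fun a => Set.univ.pi fun b =>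
      Set.Icc (-((D a + D b) / 2)) ((D a + D b) / 2) :
        Set (Matrix (Fin d ⊕ Fin d) (Fin d ⊕ Fin d) ℝ)) :=
    isCompact_univ_pi fun a => isCompact_univ_pi fun b => isCompact_Icc
  refine hbox.of_isClosed_subset ?_ ?_
  · refine isClosed_posSemidef.inter (IsClosed.inter ?_ ?_)
    · exact isClosed_eq (by unfold Matrix.toBlocks₁₁; fun_prop) (by fun_prop)
    · exact isClosed_eq (by unfold Matrix.toBlocks₂₂; fun_prop) (by fun_prop)
  · rintro F ⟨hF, h₀, h₁⟩ a - b -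
    have hD : ∀ a, F a a = D a := by
      rintro (i | i)
      · exact congrFun (congrFun h₀ i) i
      · exact congrFun (congrFun h₁ i) i
    have := abs_le_of_posSemidef hF a b
    rwa [hD, hD, abs_le] at this

/-- The isomorphism `ℝ^{2d} → ℝ^d × ℝ^d`. -/
noncomputable def splitCoords (d : ℕ) : EuclideanSpace ℝ (Fin d ⊕ Fin d) →L[ℝ] Euc d × Euc d :=
  LinearMap.toContinuousLinearMap
    { toFun := fun x => (WithLp.toLp 2 fun i => x (Sum.inl i), WithLp.toLp 2 fun i => x (Sum.inr i))
      map_add' := fun x y => by ext <;> simp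
      map_smul' := fun c x => by ext <;> simp }

/-- The pushforward of a multivariate Gaussian under a selection of coordinates. -/
lemma map_submatrix_multivariateGaussian {ι κ : Type*} [Fintype ι] [DecidableEq ι] [Fintype κ]
    [DecidableEq κ] {m : EuclideanSpace ℝ ι} {F : Matrix ι ι ℝ} (hF : F.PosSemidef) (f : κ → ι) :
    (multivariateGaussian m F).map (fun x => WithLp.toLp 2 fun k => x (f k)) =
      multivariateGaussian (WithLp.toLp 2 fun k => m (f k)) (F.submatrix f f) := by
  set L : EuclideanSpace ℝ ι →L[ℝ] EuclideanSpace ℝ κ := LinearMap.toContinuousLinearMap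
    { toFun := fun x => WithLp.toLp 2 fun k => x (f k)
      map_add' := fun x y => by ext; simp
      map_smul' := fun c x => by ext; simp }
  change (multivariateGaussian m F).map L = _
  apply IsGaussian.ext
  · simp only [id_eq, integral_id_multivariateGaussian]
    rw [ContinuousLinearMap.integral_id_map, integral_id_multivariateGaussian]
    · rfl
    · exact IsGaussian.integrable_id
  rw [← ContinuousLinearMap.toBilinForm_inj]
  refine LinearMap.BilinForm.ext_basis (EuclideanSpace.basisFun κ ℝ).toBasis fun i j ↦ ?_
  rw [ContinuousLinearMap.toBilinForm_apply, ContinuousLinearMap.toBilinForm_apply,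
    covarianceBilin_apply_eq_cov, covariance_map]
  · have (k : κ) : (fun u ↦ inner ℝ ((EuclideanSpace.basisFun κ ℝ).toBasis k) u) ∘ L =
        fun u ↦ u (f k) := by ext; simp [PiLp.inner_apply, L]
    simp_rw [this, covariance_eval_multivariateGaussian hF,
      covarianceBilin_multivariateGaussian (hF.submatrix _)]
    simp
  any_goals exact Measurable.aestronglyMeasurable (by fun_prop)
  · fun_prop
  · exact IsGaussian.memLp_two_id

/-- The Gaussian measure on `ℝ^d × ℝ^d` with means `m₀`, `m₁` and covariance matrix `F`. -/
noncomputable def blockGaussian (m₀ m₁ : Euc d) (F : Matrix (Fin d ⊕ Fin d) (Fin d ⊕ Fin d) ℝ) :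
    Measure (Euc d × Euc d) :=
  (multivariateGaussian (WithLp.toLp 2 (Sum.elim m₀ m₁)) F).map (splitCoords d)

instance (m₀ m₁ : Euc d) (F : Matrix (Fin d ⊕ Fin d) (Fin d ⊕ Fin d) ℝ) :
    IsGaussian (blockGaussian m₀ m₁ F) :=
  inferInstanceAs (IsGaussian (Measure.map _ _))

variable {m₀ m₁ : Euc d} {S₀ S₁ : Matrix (Fin d) (Fin d) ℝ}
  {F : Matrix (Fin d ⊕ Fin d) (Fin d ⊕ Fin d) ℝ}

lemma blockGaussian_mem_couplings (hF : F ∈ blockCovariances S₀ S₁) :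
    blockGaussian m₀ m₁ F ∈
      couplings (multivariateGaussian m₀ S₀) (multivariateGaussian m₁ S₁) := by
  refine ⟨inferInstance, ?_, ?_⟩
  · rw [blockGaussian, Measure.map_map measurable_fst (by fun_prop)]
    have := map_submatrix_multivariateGaussian (m := WithLp.toLp 2 (Sum.elim m₀ m₁)) hF.1
      (Sum.inl : Fin d → Fin d ⊕ Fin d)
    refine this.trans ?_
    rw [← hF.2.1]
    rfl
  · rw [blockGaussian, Measure.map_map measurable_snd (by fun_prop)]
    have := map_submatrix_multivariateGaussian (m := WithLp.toLp 2 (Sum.elim m₀ m₁)) hF.1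
      (Sum.inr : Fin d → Fin d ⊕ Fin d)
    refine this.trans ?_
    rw [← hF.2.2]
    rfl

/-- The covariance matrix of a measure on `ℝ^d × ℝ^d`. -/
noncomputable def blockCovariance (γ : Measure (Euc d × Euc d)) :
    Matrix (Fin d ⊕ Fin d) (Fin d ⊕ Fin d) ℝ :=
  Matrix.of fun a b => cov[fun z => Sum.elim z.1 z.2 a, fun z => Sum.elim z.1 z.2 b; γ]

/-- The quadratic form of a covariance matrix is the variance of a linear functional, hence
nonnegative; the diagonal blocks see only the marginals. -/
lemma blockCovariance_mem {γ : Measure (Euc d × Euc d)} (hS₀ : S₀.PosSemidef)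
    (hS₁ : S₁.PosSemidef)
    (hγ : γ ∈ couplings (multivariateGaussian m₀ S₀) (multivariateGaussian m₁ S₁)) :
    blockCovariance γ ∈ blockCovariances S₀ S₁ := by
  have := hγ.1
  have h1 := memLp_fst_of_coupling IsGaussian.memLp_two_id hγ
  have h2 := memLp_snd_of_coupling IsGaussian.memLp_two_id hγ
  have hZ : ∀ a : Fin d ⊕ Fin d,
      MemLp (fun z : Euc d × Euc d => Sum.elim z.1 z.2 a) 2 γ := by
    rintro (i | i)
    · exact memLp_coord h1 i
    · exact memLp_coord h2 i
  refine ⟨Matrix.PosSemidef.of_dotProduct_mulVec_nonneg ?_ fun x => ?_, ?_, ?_⟩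
  · ext a b
    exact covariance_comm _ _
  · have hx := covarianceBilin_apply_pi hZ (WithLp.toLp 2 x) (WithLp.toLp 2 x)
    have hnn := covarianceBilin_self_nonneg (WithLp.toLp 2 x)
      (μ := γ.map (fun z => WithLp.toLp 2 fun a : Fin d ⊕ Fin d => Sum.elim z.1 z.2 a))
    rw [hx] at hnn
    refine hnn.trans_eq ?_
    simp only [dotProduct, Matrix.mulVec, blockCovariance, Matrix.of_apply, Finset.mul_sum]
    refine Finset.sum_congr rfl fun a _ => Finset.sum_congr rfl fun b _ => ?_
    simp only [Pi.star_apply, star_trivial]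
    ring
  · ext i j
    rw [← covariance_eval_multivariateGaussian (μ := m₀) hS₀ i j, ← hγ.2.1,
      covariance_map (by fun_prop) (by fun_prop) (by fun_prop)]
    rfl
  · ext i j
    rw [← covariance_eval_multivariateGaussian (μ := m₁) hS₁ i j, ← hγ.2.2,
      covariance_map (by fun_prop) (by fun_prop) (by fun_prop)]
    rfl

lemma integral_coord_multivariateGaussian (i : Fin d) :
    ∫ x, x i ∂(multivariateGaussian m₀ S₀) = m₀ i := by
  have := (EuclideanSpace.proj (𝕜 := ℝ) i : Euc d →L[ℝ] ℝ).integral_comp_comm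
    (IsGaussian.integrable_id (μ := multivariateGaussian m₀ S₀))
  simpa using this

/-- Turns the correlation into a linear functional of the covariance matrix, the trace of the
off-diagonal block, plus a constant fixed by the means. -/
lemma integral_inner_of_coupling {γ : Measure (Euc d × Euc d)}
    (hγ : γ ∈ couplings (multivariateGaussian m₀ S₀) (multivariateGaussian m₁ S₁)) :
    ∫ z, inner ℝ z.1 z.2 ∂γ =
      ∑ i, blockCovariance γ (Sum.inl i) (Sum.inr i) + inner ℝ m₀ m₁ := by
  have := hγ.1
  have h1 := memLp_fst_of_coupling IsGaussian.memLp_two_id hγ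
  have h2 := memLp_snd_of_coupling IsGaussian.memLp_two_id hγ
  simp only [PiLp.inner_apply]
  rw [integral_finsetSum _ fun i _ => by
      simpa [mul_comm, Pi.mul_def] using (memLp_coord h1 i).integrable_mul (memLp_coord h2 i),
    ← Finset.sum_add_distrib]
  refine Finset.sum_congr rfl fun i _ => ?_
  have hcov := covariance_eq_sub (memLp_coord h1 i) (memLp_coord h2 i)
  rw [integral_fst_of_coupling hγ (f := fun x => x i) (by fun_prop),
    integral_snd_of_coupling hγ (f := fun x => x i) (by fun_prop),
    integral_coord_multivariateGaussian, integral_coord_multivariateGaussian] at hcov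
  simp only [blockCovariance, Matrix.of_apply, Sum.elim_inl, Sum.elim_inr]
  rw [hcov]
  simp [mul_comm]

lemma blockCovariance_blockGaussian (hF : F.PosSemidef) :
    blockCovariance (blockGaussian m₀ m₁ F) = F := by
  ext a b
  have hmeas : ∀ a : Fin d ⊕ Fin d,
      Measurable fun z : Euc d × Euc d => Sum.elim z.1 z.2 a := by
    rintro (i | i)
    · simp only [Sum.elim_inl]; fun_prop
    · simp only [Sum.elim_inr]; fun_prop
  rw [← covariance_eval_multivariateGaussian (μ := WithLp.toLp 2 (Sum.elim m₀ m₁)) hF a b,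
    blockCovariance, Matrix.of_apply, blockGaussian, covariance_map
      (hmeas a).aestronglyMeasurable (hmeas b).aestronglyMeasurable (by fun_prop)]
  congr 1
  · funext x
    rcases a with i | i <;> rfl
  · funext x
    rcases b with i | i <;> rfl

/-- Two Gaussian measures admit a Gaussian optimal plan. -/
theorem exists_gaussian_optimalPlan (m₀ m₁ : Euc d) (hS₀ : S₀.PosSemidef) (hS₁ : S₁.PosSemidef) :
    ∃ γ, IsGaussian γ ∧
      IsW2OptimalPlan (multivariateGaussian m₀ S₀) (multivariateGaussian m₁ S₁) γ := by
  -- The covariance of the product coupling shows that the compact set is nonempty.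
  obtain ⟨F, hF, hmax⟩ := (isCompact_blockCovariances S₀ S₁).exists_isMaxOn
    ⟨_, blockCovariance_mem (m₀ := m₀) (m₁ := m₁) hS₀ hS₁ prod_mem_couplings⟩
    (f := fun F => ∑ i, F (Sum.inl i) (Sum.inr i)) (by fun_prop)
  have hc := blockGaussian_mem_couplings (m₀ := m₀) (m₁ := m₁) hF
  refine ⟨blockGaussian m₀ m₁ F, inferInstance, hc, fun γ hγ => ?_⟩
  refine (cost_le_cost_iff IsGaussian.memLp_two_id IsGaussian.memLp_two_id hc hγ).2 ?_
  rw [integral_inner_of_coupling hc, integral_inner_of_coupling hγ,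
    blockCovariance_blockGaussian hF.1]
  have := hmax (blockCovariance_mem hS₀ hS₁ hγ)
  simp only [Set.mem_ofPred_eq] at this
  linarith

end BlockCovariance

/-! ### Optimality of affine maps with positive semidefinite linear part -/

section AffineMaps

variable {d : ℕ} {μ ν : Measure (Euc d)} {γ : Measure (Euc d × Euc d)}

/-- The form is nonnegative along `u + t A u` and vanishes at `t = 0`, so its linear coefficient `2
‖A u‖²` is zero. -/
lemma apply_eq_zero_of_inner_eq_zero {A : Euc d →L[ℝ] Euc d} (hA : A.IsPositive) {u : Euc d}
    (hu : inner ℝ (A u) u = 0) : A u = 0 := by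
  have h : ∀ t : ℝ, 0 ≤ inner ℝ (A (A u)) (A u) * (t * t) + 2 * ‖A u‖ ^ 2 * t + 0 := by
    intro t
    have := hA.inner_nonneg_left (u + t • A u)
    simp only [map_add, map_smul, inner_add_left, inner_add_right, inner_smul_left,
      inner_smul_right, hu, hA.inner_left_eq_inner_right (A u) u, real_inner_self_eq_norm_sq,
      RCLike.conj_to_real] at this
    linarith
  have := discrim_le_zero h
  rw [discrim] at this
  have h0 : ‖A u‖ ^ 2 = 0 := by nlinarith [sq_nonneg (‖A u‖ ^ 2)]
  simpa using h0

/-- A linear section of `A` over its range, extended to the whole space. It replaces `A⁻¹`, since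
`A` is singular when the target covariance is. -/
lemma exists_generalized_inverse (A : Euc d →L[ℝ] Euc d) :
    ∃ G : Euc d →L[ℝ] Euc d, ∀ x, A (G (A x)) = A x := by
  obtain ⟨g, hg⟩ := (A : Euc d →ₗ[ℝ] Euc d).rangeRestrict.exists_rightInverse_of_surjective
    (LinearMap.range_rangeRestrict _)
  obtain ⟨G, hG⟩ := g.exists_extend
  refine ⟨LinearMap.toContinuousLinearMap G, fun x => ?_⟩
  have h1 : G (A x) = g ⟨A x, LinearMap.mem_range_self _ x⟩ := LinearMap.congr_fun hG ⟨A x, _⟩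
  have h2 := LinearMap.congr_fun hg ⟨A x, LinearMap.mem_range_self _ x⟩
  simp only [LinearMap.coe_toContinuousLinearMap', h1]
  exact congrArg Subtype.val h2

/-- Integrated Fenchel–Young identity for the potential `⟨A x, x⟩ / 2 + ⟨x, b⟩`: the first two
integrals depend on the marginals only, and the last is a nonnegative duality gap. -/
lemma integral_inner_of_affine {A G : Euc d →L[ℝ] Euc d} (hA : A.IsPositive) (b : Euc d)
    (hG : ∀ᵐ y ∂ν, A (G (y - b)) = y - b) (hμ : MemLp id 2 μ) (hν : MemLp id 2 ν)
    (hγ : γ ∈ couplings μ ν) :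
    2 * ∫ z, inner ℝ z.1 z.2 ∂γ =
      ∫ x, (inner ℝ (A x) x + 2 * inner ℝ x b) ∂μ + ∫ y, inner ℝ (G (y - b)) (y - b) ∂ν -
        ∫ z, inner ℝ (A (z.1 - G (z.2 - b))) (z.1 - G (z.2 - b)) ∂γ := by
  have := hγ.1
  have h1 := memLp_fst_of_coupling hμ hγ
  have h2 : MemLp (fun z : Euc d × Euc d => z.2 - b) 2 γ :=
    (memLp_snd_of_coupling hν hγ).sub (memLp_const b)
  have h3 : MemLp (fun z : Euc d × Euc d => G (z.2 - b)) 2 γ := G.comp_memLp' h2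
  have h4 : MemLp (fun z : Euc d × Euc d => z.1 - G (z.2 - b)) 2 γ := h1.sub h3
  rw [← integral_fst_of_coupling hγ
      (by fun_prop : Continuous fun x : Euc d => inner ℝ (A x) x + 2 * inner ℝ x b),
    ← integral_snd_of_coupling hγ
      (by fun_prop : Continuous fun y : Euc d => inner ℝ (G (y - b)) (y - b)),
    ← integral_const_mul, ← integral_add, ← integral_sub]
  · rw [← hγ.2.2] at hG
    refine integral_congr_ae ?_
    filter_upwards [ae_of_ae_map measurable_snd.aemeasurable hG] with z hz
    have e1 : inner ℝ (A z.1) (G (z.2 - b)) = inner ℝ z.1 (z.2 - b) := by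
      rw [hA.inner_left_eq_inner_right, hz]
    have e2 : inner ℝ z.1 z.2 = inner ℝ z.1 (z.2 - b) + inner ℝ z.1 b := by
      rw [← inner_add_right, sub_add_cancel]
    rw [map_sub A z.1, hz, inner_sub_left (A z.1), inner_sub_right (A z.1),
      inner_sub_right (z.2 - b) z.1, e1, e2,
      real_inner_comm z.1 (z.2 - b), real_inner_comm (z.2 - b) (G (z.2 - b))]
    ring
  · exact ((integrable_inner_of_memLp (A.comp_memLp' h1) h1).add
      ((integrable_inner_of_memLp h1 (memLp_const b)).const_mul 2)).add
      (integrable_inner_of_memLp h3 h2)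
  · exact integrable_inner_of_memLp (A.comp_memLp' h4) h4
  · exact (integrable_inner_of_memLp (A.comp_memLp' h1) h1).add
      ((integrable_inner_of_memLp h1 (memLp_const b)).const_mul 2)
  · exact integrable_inner_of_memLp h3 h2

lemma graphPlan_mem_couplings [IsProbabilityMeasure μ] {T : Euc d → Euc d} (hT : Measurable T) :
    graphPlan μ T ∈ couplings μ (μ.map T) := by
  have hm : Measurable fun x => (x, T x) := by fun_prop
  refine ⟨Measure.isProbabilityMeasure_map hm.aemeasurable, ?_, ?_⟩
  · rw [graphPlan, Measure.map_map measurable_fst hm]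
    exact Measure.map_id
  · rw [graphPlan, Measure.map_map measurable_snd hm]
    rfl

/-- A coupling of `μ` with its image under `x ↦ A x + b`, where `A` is symmetric and positive
semidefinite, is optimal if and only if it is concentrated on the graph of that map. -/
theorem isW2OptimalPlan_iff_of_affine [IsProbabilityMeasure μ] {A : Euc d →L[ℝ] Euc d}
    (hA : A.IsPositive) {b : Euc d} (hμ : MemLp id 2 μ) (hν : ν = μ.map fun x => A x + b)
    (hγ : γ ∈ couplings μ ν) :
    IsW2OptimalPlan μ ν γ ↔ ∀ᵐ z ∂γ, z.2 = A z.1 + b := by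
  have hT : Measurable fun x => A x + b := by fun_prop
  have hν2 : MemLp id 2 ν := by
    rw [hν, memLp_map_measure_iff (by fun_prop) hT.aemeasurable]
    exact (A.comp_memLp' hμ).add (memLp_const b)
  obtain ⟨G, hG⟩ := exists_generalized_inverse A
  have hGν : ∀ᵐ y ∂ν, A (G (y - b)) = y - b := by
    rw [hν, ae_map_iff hT.aemeasurable (measurableSet_eq_fun (by fun_prop) (by fun_prop))]
    exact ae_of_all _ fun x => by simp [hG]
  have hid := fun {γ'} (hγ' : γ' ∈ couplings μ ν) =>
    integral_inner_of_affine hA b hGν hμ hν2 hγ'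
  have hnn : ∀ z : Euc d × Euc d,
      0 ≤ inner ℝ (A (z.1 - G (z.2 - b))) (z.1 - G (z.2 - b)) :=
    fun z => hA.inner_nonneg_left _
  have hzero : ∀ {γ' : Measure (Euc d × Euc d)}, (∀ᵐ z ∂γ', z.2 = A z.1 + b) →
      ∫ z, inner ℝ (A (z.1 - G (z.2 - b))) (z.1 - G (z.2 - b)) ∂γ' = 0 := by
    intro γ' h
    refine integral_eq_zero_of_ae ?_
    filter_upwards [h] with z hz
    simp [hz, hG]
  constructor
  · intro hopt
    have hgraph : graphPlan μ (fun x => A x + b) ∈ couplings μ ν := hν ▸ graphPlan_mem_couplings hT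
    -- The graph coupling has zero gap, so an optimal `γ` has zero gap too, and its nonnegative
    -- integrand vanishes almost everywhere.
    have hle := (cost_le_cost_iff hμ hν2 hγ hgraph).1 (hopt.2 hgraph)
    have h1 := hid hγ
    have h2 := hid hgraph
    rw [hzero (γ' := graphPlan μ (fun x => A x + b))] at h2
    · have h0 : ∫ z, inner ℝ (A (z.1 - G (z.2 - b))) (z.1 - G (z.2 - b)) ∂γ = 0 :=
        le_antisymm (by linarith) (integral_nonneg hnn)
      have := hγ.1
      have h4 : MemLp (fun z : Euc d × Euc d => z.1 - G (z.2 - b)) 2 γ :=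
        (memLp_fst_of_coupling hμ hγ).sub
          (G.comp_memLp' ((memLp_snd_of_coupling hν2 hγ).sub (memLp_const b)))
      rw [integral_eq_zero_iff_of_nonneg hnn
        (integrable_inner_of_memLp (A.comp_memLp' h4) h4)] at h0
      rw [← hγ.2.2] at hGν
      filter_upwards [h0, ae_of_ae_map measurable_snd.aemeasurable hGν] with z hz hz'
      -- A null vector of the form lies in the kernel: `A z.1 = A (G (z.2 - b)) = z.2 - b`.
      have := apply_eq_zero_of_inner_eq_zero hA hz
      rw [map_sub, hz', sub_eq_zero] at this
      rw [this, sub_add_cancel]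
    · rw [graphPlan, ae_map_iff (by fun_prop)
        (measurableSet_eq_fun measurable_snd (by fun_prop))]
      exact ae_of_all _ fun x => rfl
  · intro h
    refine ⟨hγ, fun γ' hγ' => (cost_le_cost_iff hμ hν2 hγ hγ').2 ?_⟩
    have h1 := hid hγ
    have h2 := hid hγ'
    rw [hzero h] at h1
    have : 0 ≤ ∫ z, inner ℝ (A (z.1 - G (z.2 - b))) (z.1 - G (z.2 - b)) ∂γ' :=
      integral_nonneg hnn
    linarith

lemma isW2OptimalMap_affine [IsProbabilityMeasure μ] {A : Euc d →L[ℝ] Euc d}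
    (hA : A.IsPositive) {b : Euc d} (hμ : MemLp id 2 μ) (hν : ν = μ.map fun x => A x + b) :
    IsW2OptimalMap μ ν fun x => A x + b := by
  have hT : Measurable fun x => A x + b := by fun_prop
  refine ⟨hT, (isW2OptimalPlan_iff_of_affine hA hμ hν (hν ▸ graphPlan_mem_couplings hT)).2 ?_⟩
  rw [graphPlan, ae_map_iff (by fun_prop) (measurableSet_eq_fun measurable_snd (by fun_prop))]
  exact ae_of_all _ fun x => rfl

lemma IsW2OptimalMap.ae_eq_affine [IsProbabilityMeasure μ] {A : Euc d →L[ℝ] Euc d}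
    (hA : A.IsPositive) {b : Euc d} (hμ : MemLp id 2 μ) (hν : ν = μ.map fun x => A x + b)
    {T : Euc d → Euc d} (hT : IsW2OptimalMap μ ν T) : T =ᵐ[μ] fun x => A x + b := by
  have := (isW2OptimalPlan_iff_of_affine hA hμ hν hT.2.1).1 hT.2
  have hm : Measurable fun x => (x, T x) := measurable_id.prodMk hT.1
  rw [graphPlan, ae_map_iff hm.aemeasurable
    (measurableSet_eq_fun measurable_snd (by fun_prop))] at this
  exact this

end AffineMaps

/-! ### Affine maps between Gaussians -/

section GaussianMaps

variable {d : ℕ} {S₀ S₁ : Matrix (Fin d) (Fin d) ℝ}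

open scoped MatrixOrder in
/-- The Riccati equation `M S₀ M = S₁` has a positive semidefinite solution. -/
lemma exists_posSemidef_mul_mul_eq (hS₀ : S₀.PosDef) (hS₁ : S₁.PosSemidef) :
    ∃ M : Matrix (Fin d) (Fin d) ℝ, M.PosSemidef ∧ M * S₀ * M = S₁ := by
  set R := CFC.sqrt S₀
  have hRR : R * R = S₀ := CFC.sqrt_mul_sqrt_self S₀ hS₀.posSemidef.nonneg
  have hRpsd : R.PosSemidef := Matrix.nonneg_iff_posSemidef.1 (CFC.sqrt_nonneg S₀)
  have hdet : IsUnit R.det := by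
    have h : IsUnit (R * R).det := by
      rw [hRR]
      exact isUnit_iff_ne_zero.2 hS₀.det_pos.ne'
    rw [Matrix.det_mul] at h
    exact isUnit_of_mul_isUnit_left h
  have hQ : (R * S₁ * R).PosSemidef := by
    have := hS₁.conjTranspose_mul_mul_same R
    rwa [hRpsd.1.eq] at this
  set P := CFC.sqrt (R * S₁ * R)
  have hPP : P * P = R * S₁ * R := CFC.sqrt_mul_sqrt_self _ hQ.nonneg
  have hPpsd : P.PosSemidef := Matrix.nonneg_iff_posSemidef.1 (CFC.sqrt_nonneg _)
  -- With `R = S₀^(1/2)`, the equation says that `R M R` squares to `R S₁ R`; take the positive root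
  -- `P` and solve for `M`.
  refine ⟨R⁻¹ * P * R⁻¹, ?_, ?_⟩
  · have := hPpsd.conjTranspose_mul_mul_same R⁻¹
    rwa [hRpsd.inv.1.eq] at this
  · calc R⁻¹ * P * R⁻¹ * S₀ * (R⁻¹ * P * R⁻¹)
        = R⁻¹ * P * ((R⁻¹ * R) * (R * R⁻¹)) * P * R⁻¹ := by rw [← hRR]; simp only [mul_assoc]
      _ = R⁻¹ * (P * P) * R⁻¹ := by
          rw [Matrix.nonsing_inv_mul R hdet, Matrix.mul_nonsing_inv R hdet]
          simp only [mul_assoc, one_mul]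
      _ = (R⁻¹ * R) * S₁ * (R * R⁻¹) := by rw [hPP]; simp only [mul_assoc]
      _ = S₁ := by
          rw [Matrix.nonsing_inv_mul R hdet, Matrix.mul_nonsing_inv R hdet, one_mul, mul_one]

/-- A nondegenerate Gaussian measure is mapped onto any other Gaussian measure by an affine map
whose linear part is symmetric and positive semidefinite. -/
lemma exists_affine_map_multivariateGaussian (m₀ m₁ : Euc d) (hS₀ : S₀.PosDef)
    (hS₁ : S₁.PosSemidef) : ∃ (A : Euc d →L[ℝ] Euc d) (b : Euc d), A.IsPositive ∧
      multivariateGaussian m₁ S₁ = (multivariateGaussian m₀ S₀).map fun x => A x + b := by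
  obtain ⟨M, hM, hMS⟩ := exists_posSemidef_mul_mul_eq hS₀ hS₁
  set A : Euc d →L[ℝ] Euc d := Matrix.toEuclideanCLM (𝕜 := ℝ) M with hAdef
  have hA : A.IsPositive := by
    have := Matrix.isPositive_toEuclideanLin_iff.2 hM
    exact this
  refine ⟨A, m₁ - A m₀, hA, ?_⟩
  have hcomp : (multivariateGaussian m₀ S₀).map (fun x => A x + (m₁ - A m₀)) =
      ((multivariateGaussian m₀ S₀).map A).map (fun x => (m₁ - A m₀) + x) := by
    rw [Measure.map_map (by fun_prop) (by fun_prop)]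
    congr 1
    funext x
    exact add_comm _ _
  rw [hcomp]
  apply IsGaussian.ext
  · have hint : Integrable (fun x : Euc d => x) ((multivariateGaussian m₀ S₀).map A) :=
      IsGaussian.integrable_id
    simp only [id_eq, integral_id_multivariateGaussian]
    rw [integral_map (by fun_prop) (by fun_prop), integral_add (integrable_const _) hint,
      ContinuousLinearMap.integral_id_map IsGaussian.integrable_id,
      integral_id_multivariateGaussian]
    simp
  · rw [covarianceBilin_map_const_add]
    ext x y
    rw [covarianceBilin_map IsGaussian.memLp_two_id, hA.isSelfAdjoint.adjoint_eq,
      covarianceBilin_multivariateGaussian hS₁,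
      covarianceBilin_multivariateGaussian hS₀.posSemidef, ← hMS]
    simp only [hAdef, Matrix.ofLp_toEuclideanCLM]
    rw [← Matrix.mulVec_mulVec, ← Matrix.mulVec_mulVec, Matrix.dotProduct_mulVec _ M,
      ← Matrix.mulVec_transpose]
    congr 1
    have : M.transpose = M := by simpa using hM.1.eq
    rw [this]

end GaussianMaps

/-! ### Gluing and splitting mixtures -/

section Mixtures

variable {d : ℕ}

lemma map_sum_smul_measure {X Y ι : Type*} [MeasurableSpace X] [MeasurableSpace Y]
    (s : Finset ι) (w : ι → ℝ≥0) (γ : ι → Measure X) {f : X → Y} (hf : Measurable f) :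
    (∑ i ∈ s, w i • γ i).map f = ∑ i ∈ s, w i • (γ i).map f := by
  ext t ht
  simp only [Measure.map_apply hf ht, Measure.coe_finsetSum, Finset.sum_apply, Measure.smul_apply]

lemma cost_sum_smul {ι : Type*} (s : Finset ι) (w : ι → ℝ≥0)
    (γ : ι → Measure (Euc d × Euc d)) :
    cost (∑ i ∈ s, w i • γ i) = ∑ i ∈ s, (w i : ℝ≥0∞) * cost (γ i) := by
  simp only [cost, lintegral_finsetSum_measure, lintegral_smul_measure, ENNReal.smul_def,
    smul_eq_mul]

lemma isGaussianMixture_sum_smul {E ι : Type*} [TopologicalSpace E] [AddCommMonoid E] [Module ℝ E]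
    [MeasurableSpace E] [Fintype ι] {p : ι → ℝ≥0} {ν : ι → Measure E} (hp : ∑ i, p i = 1)
    (hν : ∀ i, IsGaussian (ν i)) : IsGaussianMixture (∑ i, p i • ν i) := by
  let e := (Fintype.equivFin ι).symm
  exact ⟨Fintype.card ι, p ∘ e, ν ∘ e, (e.sum_comp p).trans hp, fun k => hν (e k),
    (e.sum_comp fun i => p i • ν i).symm⟩

open scoped Classical in
/-- If two weighted families give the same total weight to each point, then the weights of the
first can be redistributed onto the second along equal points. -/
lemma exists_weight_splitting {X ι κ : Type*} [Fintype ι] [Fintype κ] {β : ι → X} {c : κ → X}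
    {p : ι → ℝ≥0} {q : κ → ℝ≥0}
    (h : ∀ g, ∑ i with β i = g, p i = ∑ k with c k = g, q k) :
    ∃ a : ι → κ → ℝ≥0, (∀ i k, a i k ≠ 0 → c k = β i) ∧ (∀ i, p i ≠ 0 → ∑ k, a i k = 1) ∧
      ∀ k, ∑ i, p i * a i k = q k := by
  -- Share `i` among the `k` at the same point, proportionally to `q k`. A zero denominator makes
  -- the quotient `0`; by `h` this happens only when `p i = 0`, where the row sum is not required to
  -- be `1`.
  refine ⟨fun i k => if c k = β i then q k / ∑ k' with c k' = β i, q k' else 0, ?_, ?_, ?_⟩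
  · intro i k hik
    by_contra hne
    exact hik (if_neg hne)
  · intro i hi
    rw [← Finset.sum_filter, ← Finset.sum_div, div_self]
    rw [← h]
    exact fun h0 => hi (Finset.sum_eq_zero_iff.1 h0 i (by simp))
  · intro k
    have : ∀ i, p i * (if c k = β i then q k / ∑ k' with c k' = β i, q k' else 0) =
        if β i = c k then p i * (q k / ∑ k' with c k' = c k, q k') else 0 := by
      intro i
      by_cases hi : β i = c k
      · simp [hi]
      · rw [if_neg hi, if_neg (Ne.symm hi), mul_zero]
    rw [Finset.sum_congr rfl fun i _ => this i, ← Finset.sum_filter, ← Finset.sum_mul, h]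
    by_cases h0 : ∑ k' with c k' = c k, q k' = 0
    · rw [h0, zero_mul]
      exact (Finset.sum_eq_zero_iff.1 h0 k (by simp)).symm
    · rw [mul_div_cancel₀ _ h0]

variable {K L : ℕ} {p : Fin K → ℝ≥0} {q : Fin L → ℝ≥0}

lemma sum_discreteCoupling {w : Matrix (Fin K) (Fin L) ℝ≥0} (hp : ∑ k, p k = 1)
    (hw : w ∈ discreteCouplings p q) : ∑ x : Fin K × Fin L, w x.1 x.2 = 1 := by
  rw [Fintype.sum_prod_type, ← hp]
  exact Finset.sum_congr rfl fun k _ => hw.1 k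

lemma mul_mem_discreteCouplings (hp : ∑ k, p k = 1) (hq : ∑ l, q l = 1) :
    (Matrix.of fun k l => p k * q l) ∈ discreteCouplings p q := by
  refine ⟨fun k => ?_, fun l => ?_⟩
  · simp [← Finset.mul_sum, hq]
  · simp [← Finset.sum_mul, hp]

lemma isCompact_discreteCouplings : IsCompact (discreteCouplings p q) := by
  have hbox : IsCompact (Set.univ.pi fun k => Set.univ.pi fun _ => Set.Icc 0 (p k) :
      Set (Matrix (Fin K) (Fin L) ℝ≥0)) :=
    isCompact_univ_pi fun k => isCompact_univ_pi fun l => isCompact_Icc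
  refine hbox.of_isClosed_subset ?_ ?_
  · simp only [discreteCouplings, Set.ofPred_and, Set.ofPred_forall]
    refine IsClosed.inter (isClosed_iInter fun k => ?_) (isClosed_iInter fun l => ?_)
    · exact isClosed_eq (by fun_prop) (by fun_prop)
    · exact isClosed_eq (by fun_prop) (by fun_prop)
  · rintro w hw k - l -
    refine ⟨zero_le, ?_⟩
    rw [← hw.1 k]
    exact Finset.single_le_sum (f := fun l => w k l) (fun _ _ => zero_le) (Finset.mem_univ l)

variable {c₀ : Fin K → Measure (Euc d)} {c₁ : Fin L → Measure (Euc d)}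

/-- Finiteness of the coefficients matters: multiplication by `∞` is not continuous at `0`. -/
lemma continuous_discreteCost (h : ∀ k l, W2sq (c₀ k) (c₁ l) ≠ ∞) :
    Continuous (discreteCost c₀ c₁) := by
  unfold discreteCost
  refine continuous_finsetSum _ fun k _ => continuous_finsetSum _ fun l _ => ?_
  exact (ENNReal.continuous_mul_const (h k l)).comp
    (ENNReal.continuous_coe.comp (by fun_prop : Continuous fun w : Matrix _ _ ℝ≥0 => w k l))

lemma discreteCost_ne_top (h : ∀ k l, W2sq (c₀ k) (c₁ l) ≠ ∞) (w : Matrix (Fin K) (Fin L) ℝ≥0) :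
    discreteCost c₀ c₁ w ≠ ∞ :=
  ENNReal.sum_ne_top.2 fun k _ => ENNReal.sum_ne_top.2 fun l _ =>
    ENNReal.mul_ne_top ENNReal.coe_ne_top (h k l)

lemma sum_smul_mem_couplings {w : Matrix (Fin K) (Fin L) ℝ≥0} (hp : ∑ k, p k = 1)
    (hw : w ∈ discreteCouplings p q) {γ : Fin K → Fin L → Measure (Euc d × Euc d)}
    (hγ : ∀ k l, γ k l ∈ couplings (c₀ k) (c₁ l)) :
    ∑ x : Fin K × Fin L, w x.1 x.2 • γ x.1 x.2 ∈
      couplings (∑ k, p k • c₀ k) (∑ l, q l • c₁ l) := by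
  refine ⟨⟨?_⟩, ?_, ?_⟩
  · have hone : ∀ k l, γ k l Set.univ = 1 := fun k l => (hγ k l).1.measure_univ
    simp only [Measure.coe_finsetSum, Finset.sum_apply, Measure.smul_apply, hone,
      ENNReal.smul_def, smul_eq_mul, mul_one]
    exact_mod_cast sum_discreteCoupling hp hw
  · rw [map_sum_smul_measure _ _ _ measurable_fst, Fintype.sum_prod_type]
    refine Finset.sum_congr rfl fun k _ => ?_
    simp only [(hγ _ _).2.1, ← Finset.sum_smul, hw.1 k]
  · rw [map_sum_smul_measure _ _ _ measurable_snd, Fintype.sum_prod_type_right]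
    refine Finset.sum_congr rfl fun l _ => ?_
    simp only [(hγ _ _).2.2, ← Finset.sum_smul, hw.2 l]

/-- Gluing Gaussian optimal plans along a discrete coupling. -/
lemma sum_smul_mem_gmmCouplings {w : Matrix (Fin K) (Fin L) ℝ≥0} (hp : ∑ k, p k = 1)
    (hw : w ∈ discreteCouplings p q) {γ : Fin K → Fin L → Measure (Euc d × Euc d)}
    (hγ : ∀ k l, IsGaussian (γ k l) ∧ IsW2OptimalPlan (c₀ k) (c₁ l) (γ k l)) :
    ∑ k, ∑ l, w k l • γ k l ∈ gmmCouplings (∑ k, p k • c₀ k) (∑ l, q l • c₁ l) ∧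
      cost (∑ k, ∑ l, w k l • γ k l) = discreteCost c₀ c₁ w := by
  rw [← Fintype.sum_prod_type' fun k l => w k l • γ k l]
  refine ⟨⟨sum_smul_mem_couplings hp hw fun k l => (hγ k l).2.1,
    isGaussianMixture_sum_smul (sum_discreteCoupling hp hw) fun x => (hγ x.1 x.2).1⟩, ?_⟩
  rw [cost_sum_smul, Fintype.sum_prod_type]
  refine Finset.sum_congr rfl fun k _ => Finset.sum_congr rfl fun l _ => ?_
  rw [cost_eq_W2sq (hγ k l).2]

/-- Every Gaussian mixture coupling is at least as expensive as some discrete coupling. -/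
lemma exists_discreteCost_le [∀ k, IsGaussian (c₀ k)] [∀ l, IsGaussian (c₁ l)]
    {γ : Measure (Euc d × Euc d)}
    (hγ : γ ∈ gmmCouplings (∑ k, p k • c₀ k) (∑ l, q l • c₁ l)) :
    ∃ w ∈ discreteCouplings p q, discreteCost c₀ c₁ w ≤ cost γ := by
  obtain ⟨⟨-, hfst, hsnd⟩, N, r, ν, -, hν, rfl⟩ := hγ
  rw [map_sum_smul_measure _ _ _ measurable_fst] at hfst
  rw [map_sum_smul_measure _ _ _ measurable_snd] at hsnd
  have hG₀ : ∀ j, IsGaussian ((ν j).map Prod.fst) := fun j =>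
    isGaussian_map (ContinuousLinearMap.fst ℝ (Euc d) (Euc d))
  have hG₁ : ∀ j, IsGaussian ((ν j).map Prod.snd) := fun j =>
    isGaussian_map (ContinuousLinearMap.snd ℝ (Euc d) (Euc d))
  obtain ⟨a, ha, ha1, har⟩ := exists_weight_splitting (gaussianMixture_identifiable _ _ hfst)
  obtain ⟨b, hb, hb1, hbr⟩ := exists_weight_splitting (gaussianMixture_identifiable _ _ hsnd)
  -- Given the component `j`, its source label `k` and target label `l` are split independently. A
  -- label gets weight only if its Gaussian equals the corresponding marginal of `ν j`, so the pair
  -- `(k, l)` has the `W2sq` of those marginals.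
  refine ⟨Matrix.of fun k l => ∑ j, r j * a j k * b j l, ⟨fun k => ?_, fun l => ?_⟩, ?_⟩
  · simp only [Matrix.of_apply]
    rw [Finset.sum_comm, ← har k]
    refine Finset.sum_congr rfl fun j _ => ?_
    rw [← Finset.mul_sum]
    by_cases hj : r j = 0
    · simp [hj]
    · rw [hb1 j hj, mul_one]
  · simp only [Matrix.of_apply]
    rw [Finset.sum_comm, ← hbr l]
    refine Finset.sum_congr rfl fun j _ => ?_
    rw [← Finset.sum_mul, ← Finset.mul_sum]
    by_cases hj : r j = 0
    · simp [hj]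
    · rw [ha1 j hj, mul_one]
  · rw [cost_sum_smul]
    have hterm : ∀ j k l, ((r j * a j k * b j l : ℝ≥0) : ℝ≥0∞) * W2sq (c₀ k) (c₁ l) =
        ((r j * a j k * b j l : ℝ≥0) : ℝ≥0∞) *
          W2sq ((ν j).map Prod.fst) ((ν j).map Prod.snd) := by
      intro j k l
      by_cases h : a j k = 0
      · simp [h]
      by_cases h' : b j l = 0
      · simp [h']
      rw [ha j k h, hb j l h']
    calc discreteCost c₀ c₁ (Matrix.of fun k l => ∑ j, r j * a j k * b j l)
        = ∑ k, ∑ l, ∑ j, ((r j * a j k * b j l : ℝ≥0) : ℝ≥0∞) *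
            W2sq ((ν j).map Prod.fst) ((ν j).map Prod.snd) := by
          unfold discreteCost
          simp only [Matrix.of_apply, ENNReal.ofNNReal_finsetSum, Finset.sum_mul, hterm]
      _ = ∑ j, ((∑ k, ∑ l, r j * a j k * b j l : ℝ≥0) : ℝ≥0∞) *
            W2sq ((ν j).map Prod.fst) ((ν j).map Prod.snd) := by
          simp only [ENNReal.ofNNReal_finsetSum, Finset.sum_mul]
          rw [Finset.sum_comm]
          rw [Finset.sum_congr rfl fun l _ => Finset.sum_comm, Finset.sum_comm]
          exact Finset.sum_congr rfl fun j _ => Finset.sum_comm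
      _ ≤ ∑ j, (r j : ℝ≥0∞) * cost (ν j) := by
          refine Finset.sum_le_sum fun j _ => ?_
          have hsum : ∑ k, ∑ l, r j * a j k * b j l = r j := by
            simp only [← Finset.mul_sum]
            by_cases hj : r j = 0
            · simp [hj]
            · rw [hb1 j hj]
              simp [← Finset.mul_sum, ha1 j hj]
          rw [hsum]
          gcongr
          have := hν j
          exact iInf₂_le (ν j) ⟨inferInstance, rfl, rfl⟩

end Mixtures

/-! ### Gaussian graph plans and the main theorem -/

lemma isGaussian_graphPlan_affine {d : ℕ} {μ : Measure (Euc d)} [IsGaussian μ]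
    (A : Euc d →L[ℝ] Euc d) (b : Euc d) : IsGaussian (graphPlan μ fun x => A x + b) := by
  have h : graphPlan μ (fun x => A x + b) =
      (μ.map ((ContinuousLinearMap.id ℝ (Euc d)).prod A)).map fun z => z + ((0 : Euc d), b) := by
    rw [graphPlan, Measure.map_map (by fun_prop) (by fun_prop)]
    congr 1
    funext x
    simp
  rw [h]
  infer_instance

/-- Optimal maps out of a nondegenerate Gaussian measure have Gaussian graph plans. -/
lemma IsW2OptimalMap.isGaussian_graphPlan {d : ℕ} {m₀ m₁ : Euc d}
    {S₀ S₁ : Matrix (Fin d) (Fin d) ℝ} (hS₀ : S₀.PosDef) (hS₁ : S₁.PosSemidef)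
    {T : Euc d → Euc d}
    (hT : IsW2OptimalMap (multivariateGaussian m₀ S₀) (multivariateGaussian m₁ S₁) T) :
    IsGaussian (graphPlan (multivariateGaussian m₀ S₀) T) := by
  obtain ⟨A, b, hA, hmap⟩ := exists_affine_map_multivariateGaussian m₀ m₁ hS₀ hS₁
  have h := hT.ae_eq_affine hA IsGaussian.memLp_two_id hmap
  have : graphPlan (multivariateGaussian m₀ S₀) T =
      graphPlan (multivariateGaussian m₀ S₀) fun x => A x + b :=
    Measure.map_congr (h.mono fun x hx => by simp only [hx])
  rw [this]
  exact isGaussian_graphPlan_affine A b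

end GMMTransport

open GMMTransport in
theorem mainTheorem1 {d K₀ K₁ : ℕ}
    (p₀ : Fin K₀ → ℝ≥0) (p₁ : Fin K₁ → ℝ≥0) (hp₀ : ∑ k, p₀ k = 1) (hp₁ : ∑ l, p₁ l = 1)
    (m₀ : Fin K₀ → EuclideanSpace ℝ (Fin d)) (m₁ : Fin K₁ → EuclideanSpace ℝ (Fin d))
    (S₀ : Fin K₀ → Matrix (Fin d) (Fin d) ℝ) (S₁ : Fin K₁ → Matrix (Fin d) (Fin d) ℝ)
    (hS₀ : ∀ k, (S₀ k).PosSemidef) (hS₁ : ∀ l, (S₁ l).PosSemidef)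
    (c₀ : Fin K₀ → Measure (EuclideanSpace ℝ (Fin d)))
    (c₁ : Fin K₁ → Measure (EuclideanSpace ℝ (Fin d)))
    (hc₀ : ∀ k, c₀ k = multivariateGaussian (m₀ k) (S₀ k))
    (hc₁ : ∀ l, c₁ l = multivariateGaussian (m₁ l) (S₁ l))
    (μ₀ μ₁ : Measure (EuclideanSpace ℝ (Fin d)))
    (hμ₀ : μ₀ = ∑ k, p₀ k • c₀ k) (hμ₁ : μ₁ = ∑ l, p₁ l • c₁ l) :
    -- the discrete formula, with a minimum that is attained
    MW2sq μ₀ μ₁ ≠ ∞ ∧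
    IsLeast (discreteCost c₀ c₁ '' discreteCouplings p₀ p₁) (MW2sq μ₀ μ₁) ∧
    -- Gaussian optimal plans between components exist; so do optimal maps, uniquely almost
    -- everywhere, when the source covariance is nonsingular
    (∀ k l, ∃ γ, IsGaussian γ ∧ IsW2OptimalPlan (c₀ k) (c₁ l) γ) ∧
    (∀ k l, (S₀ k).PosDef →
      (∃ T, IsW2OptimalMap (c₀ k) (c₁ l) T) ∧
      ∀ T T', IsW2OptimalMap (c₀ k) (c₁ l) T → IsW2OptimalMap (c₀ k) (c₁ l) T' →
        T =ᵐ[c₀ k] T') ∧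
    -- every discrete minimizer yields optimal plans for `MW₂`
    ∀ w ∈ discreteCouplings p₀ p₁, IsMinOn (discreteCost c₀ c₁) (discreteCouplings p₀ p₁) w →
      (∀ γ : Fin K₀ → Fin K₁ →
          Measure (EuclideanSpace ℝ (Fin d) × EuclideanSpace ℝ (Fin d)),
        (∀ k l, IsGaussian (γ k l) ∧ IsW2OptimalPlan (c₀ k) (c₁ l) (γ k l)) →
        IsMW2OptimalPlan μ₀ μ₁ (∑ k, ∑ l, w k l • γ k l)) ∧
      ((∀ k, (S₀ k).PosDef) →
        ∀ T : Fin K₀ → Fin K₁ → EuclideanSpace ℝ (Fin d) → EuclideanSpace ℝ (Fin d),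
        (∀ k l, IsW2OptimalMap (c₀ k) (c₁ l) (T k l)) →
        IsMW2OptimalPlan μ₀ μ₁ (∑ k, ∑ l, w k l • graphPlan (c₀ k) (T k l))) := by
  have hG₀ : ∀ k, IsGaussian (c₀ k) := fun k => by rw [hc₀]; infer_instance
  have hG₁ : ∀ l, IsGaussian (c₁ l) := fun l => by rw [hc₁]; infer_instance
  have hfin : ∀ k l, W2sq (c₀ k) (c₁ l) ≠ ∞ := fun k l =>
    W2sq_ne_top IsGaussian.memLp_two_id IsGaussian.memLp_two_id
  have hplans : ∀ k l, ∃ γ, IsGaussian γ ∧ IsW2OptimalPlan (c₀ k) (c₁ l) γ := fun k l => by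
    rw [hc₀, hc₁]
    exact exists_gaussian_optimalPlan (m₀ k) (m₁ l) (hS₀ k) (hS₁ l)
  subst hμ₀ hμ₁
  have hglue : ∀ w ∈ discreteCouplings p₀ p₁,
      IsMinOn (discreteCost c₀ c₁) (discreteCouplings p₀ p₁) w → ∀ γ : Fin K₀ → Fin K₁ →
        Measure (EuclideanSpace ℝ (Fin d) × EuclideanSpace ℝ (Fin d)),
      (∀ k l, IsGaussian (γ k l) ∧ IsW2OptimalPlan (c₀ k) (c₁ l) (γ k l)) →
      IsMW2OptimalPlan (∑ k, p₀ k • c₀ k) (∑ l, p₁ l • c₁ l) (∑ k, ∑ l, w k l • γ k l) := by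
    intro w hw hmin γ hγ
    obtain ⟨hmem, hcost⟩ := sum_smul_mem_gmmCouplings hp₀ hw hγ
    refine ⟨hmem, fun γ' hγ' => ?_⟩
    obtain ⟨w', hw', hle⟩ := exists_discreteCost_le hγ'
    exact (hcost.trans_le (hmin hw')).trans hle
  obtain ⟨w, hw, hmin⟩ := (isCompact_discreteCouplings (p := p₀) (q := p₁)).exists_isMinOn
    ⟨_, mul_mem_discreteCouplings hp₀ hp₁⟩ (continuous_discreteCost hfin).continuousOn
  choose γ hγ using hplans
  have hMW : MW2sq (∑ k, p₀ k • c₀ k) (∑ l, p₁ l • c₁ l) = discreteCost c₀ c₁ w := by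
    obtain ⟨hmem, hcost⟩ := sum_smul_mem_gmmCouplings hp₀ hw hγ
    rw [← hcost]
    exact le_antisymm (iInf₂_le _ hmem) (le_iInf₂ fun γ' hγ' => (hglue w hw hmin γ hγ).2 hγ')
  -- Part (ii) is part (i) applied to the graph plans; only their Gaussianity remains to be shown.
  refine ⟨hMW ▸ discreteCost_ne_top hfin w, ⟨⟨w, hw, hMW.symm⟩, ?_⟩, fun k l => ⟨_, hγ k l⟩, ?_,
    fun w hw hmin => ⟨hglue w hw hmin, fun hpd T hT => hglue w hw hmin _ fun k l =>
      ⟨?_, (hT k l).2⟩⟩⟩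
  · rintro _ ⟨w', hw', rfl⟩
    exact hMW.trans_le (hmin hw')
  · intro k l hpd
    obtain ⟨A, b, hA, hmap⟩ := exists_affine_map_multivariateGaussian (m₀ k) (m₁ l) hpd (hS₁ l)
    rw [← hc₀, ← hc₁] at hmap
    refine ⟨⟨_, isW2OptimalMap_affine hA IsGaussian.memLp_two_id hmap⟩, fun T T' hT hT' => ?_⟩
    exact (hT.ae_eq_affine hA IsGaussian.memLp_two_id hmap).trans
      (hT'.ae_eq_affine hA IsGaussian.memLp_two_id hmap).symm
  · have h := hT k l
    rw [hc₀, hc₁] at h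
    rw [hc₀]
    exact h.isGaussian_graphPlan (hpd k) (hS₁ l)
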